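/- Let $r \in \{2,3,4,5\}$. Let $G$ be a finite biclique, that is, a complete bipartite graph with two nonempty finite vertex classes $A$ and $B$, and let every edge of $G$ be assigned one of $r$ colors, in an arbitrary way. A monochromatic component is a connected component of the subgraph formed by all the edges of one color together with their endpoints. Then there are at most $2r-2$ monochromatic components, of possibly different colors, such that every vertex of $G$ belongs to at least one of them. -/

import Mathlib

namespace SimpleGraph

variable {V : Type*} {G : SimpleGraph V} {K : Type*}

/-- A monochromatic component of an edge-coloured graph: a colour `k` together with a connected
component of the subgraph formed by the edges of colour `k`. That subgraph is here a graph on all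
of `V`; the vertices that no edge of colour `k` meets would be one-vertex components of it, and
these are not counted as monochromatic components. -/
structure EdgeLabeling.MonochromaticComponent (C : G.EdgeLabeling K) where
  color : K
  component : (C.labelGraph color).ConnectedComponent
  nontrivial : component.supp.Nontrivial

/-- The vertex set of a monochromatic component. -/
def EdgeLabeling.MonochromaticComponent.verts {C : G.EdgeLabeling K}
    (M : C.MonochromaticComponent) : Set V :=
  M.component.supp

/-- The vertex set of `G` can be covered by the vertices of at most `n` monochromatic
components of the edge colouring `C`. -/
def EdgeLabeling.CoverableBy (C : G.EdgeLabeling K) (n : ℕ) : Prop :=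
  ∃ S : Finset C.MonochromaticComponent, S.card ≤ n ∧ ∀ v : V, ∃ M ∈ S, v ∈ M.verts

end SimpleGraph

/-! ### Rank bound for products of coordinate differences. -/

section MultilinearRank

open Finset

variable {ι β K : Type*} [DecidableEq ι] [Field K]

/-! Send each vertex to the vector of its components, one entry per colour. A vector from `A` and
one from `B` agree at the colour of the joining edge, and `exists_cover` asks for 2r-2 entries
meeting all vectors. If there are none, testing suitable sets of 2r-2 entries forces a rigid
structure: `a ∈ P` and `b ∈ Q` agree exactly once, each coordinate takes at least 2r-1 values, and
only one side, say `Q`, can have isolated vectors, say q of them.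

For a fixed coordinate i, the matrix `pairing i a b` is block diagonal by the value at i. A block
has rank at least 2, or at least 1 if it contains an isolated vector, so the total rank is at least
2(2r-1) - q. Being multi-affine in r-1 variables, the matrix has rank at most 2^(r-1). Since q ≤ r,
this is absurd for r ≤ 4. For r = 5, `card_isolated_add_two_lt` gives q ≤ 2, so 18 - q ≤ 16 is
tight, and `card_lt_of_separated` rules out equality. -/

theorem linearIndependent_prod_neg (J : Finset ι) (D : Finset β) (y : β → ι → K)
    (X : Set (ι → K))
    (h : ∀ c : β → K, (∀ x ∈ X, ∑ b ∈ D, c b * ∏ j ∈ J, (x j - y b j) = 0) → ∀ b ∈ D, c b = 0) :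
    LinearIndependent K
      (fun (b : D) (T : J.powerset) => ∏ j ∈ J \ (T : Finset ι), (-y b j)) := by
  classical
  rw [Fintype.linearIndependent_iff]
  intro g hg b
  have key := h (fun b => if hb : b ∈ D then g ⟨b, hb⟩ else 0) ?_ b b.2
  · simpa using key
  intro x _
  rw [← Finset.sum_coe_sort D]
  simp only [Finset.coe_mem, dite_true, Subtype.coe_eta]
  -- Expanding over subsets `T` separates the monomials in `x` from the coefficient vectors of `b`,
  -- so a relation among the latter holds at every `x`.
  have : ∀ b : D, ∏ j ∈ J, (x j - y b j) =
      ∑ T : J.powerset, (∏ j ∈ (T : Finset ι), x j) * ∏ j ∈ J \ (T : Finset ι), (-y b j) := by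
    intro b
    simp only [sub_eq_add_neg]
    rw [Finset.prod_add, ← Finset.sum_coe_sort J.powerset]
  simp only [this, Finset.mul_sum]
  rw [Finset.sum_comm]
  refine Finset.sum_eq_zero fun T _ => ?_
  have hT := congrFun hg T
  simp only [Finset.sum_apply, Pi.smul_apply, smul_eq_mul, Pi.zero_apply] at hT
  calc _ = (∏ j ∈ (T : Finset ι), x j) *
        ∑ b : D, g b * ∏ j ∈ J \ (T : Finset ι), (-y b j) := by
        rw [Finset.mul_sum]; exact Finset.sum_congr rfl fun _ _ => by ring
    _ = 0 := by rw [hT, mul_zero]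

theorem card_le_two_pow_of_separated (J : Finset ι) (D : Finset β) (y : β → ι → K)
    (X : Set (ι → K))
    (h : ∀ c : β → K, (∀ x ∈ X, ∑ b ∈ D, c b * ∏ j ∈ J, (x j - y b j) = 0) → ∀ b ∈ D, c b = 0) :
    #D ≤ 2 ^ #J := by
  simpa using (linearIndependent_prod_neg J D y X h).fintype_card_le_finrank

/-- At equality the coefficient vectors span, so proportional values force proportional monomials.
Those of `∅` and `{j}` recover `x j`. -/
theorem eq_of_proportional_of_card_eq (J : Finset ι) (D : Finset β) (y : β → ι → K)
    (X : Set (ι → K))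
    (h : ∀ c : β → K, (∀ x ∈ X, ∑ b ∈ D, c b * ∏ j ∈ J, (x j - y b j) = 0) → ∀ b ∈ D, c b = 0)
    (hD : #D = 2 ^ #J) {x x' : ι → K} {e e' : K} (he : e ≠ 0)
    (hx : ∀ b ∈ D, e * ∏ j ∈ J, (x j - y b j) = e' * ∏ j ∈ J, (x' j - y b j)) :
    ∀ j ∈ J, x j = x' j := by
  have hspan := (linearIndependent_prod_neg J D y X h).span_eq_top_of_card_eq_finrank'
    (by simpa using hD)
  let u : J.powerset → K := fun T =>
    e * ∏ j ∈ (T : Finset ι), x j - e' * ∏ j ∈ (T : Finset ι), x' j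
  let L : (J.powerset → K) →ₗ[K] K := ∑ T, u T • LinearMap.proj T
  have hL : L = 0 := by
    refine LinearMap.ext_on_range hspan fun b => ?_
    have := hx b b.2
    simp only [sub_eq_add_neg] at this
    rw [Finset.prod_add, Finset.prod_add, ← Finset.sum_coe_sort J.powerset,
      ← Finset.sum_coe_sort J.powerset, Finset.mul_sum, Finset.mul_sum, ← sub_eq_zero,
      ← Finset.sum_sub_distrib] at this
    simp only [L, LinearMap.sum_apply, LinearMap.smul_apply, LinearMap.proj_apply, smul_eq_mul,
      LinearMap.zero_apply, u]
    rw [← this]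
    exact Finset.sum_congr rfl fun _ _ => by ring
  have hu : ∀ T (hT : T ∈ J.powerset), e * ∏ j ∈ T, x j = e' * ∏ j ∈ T, x' j := by
    intro T hT
    have := LinearMap.congr_fun hL (Pi.single ⟨T, hT⟩ 1)
    simp only [L, LinearMap.sum_apply, LinearMap.smul_apply, LinearMap.proj_apply, smul_eq_mul,
      LinearMap.zero_apply, Pi.single_apply, mul_ite, mul_one, mul_zero, Finset.sum_ite_eq',
      Finset.mem_univ, if_true, u] at this
    exact sub_eq_zero.1 this
  intro j hj
  have h0 := hu ∅ (by simp)
  have h1 := hu {j} (by simpa using hj)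
  simp only [prod_empty, mul_one, prod_singleton] at h0 h1
  rw [← h0] at h1
  exact mul_left_cancel₀ he h1

end MultilinearRank

/-! ### Nonvanishing minors at generic points. -/

section GenericPoints

variable {ι V : Type*}

/-- If `a, a'` and `b, b'` both differ at some coordinate `i`, then the minor of the matrix of
products `∏ j, (X (j, a j) - X (j, b j))` on these rows and columns does not vanish. -/
theorem MvPolynomial.prod_X_sub_X_minor_ne_zero [DecidableEq ι] [DecidableEq V]
    (J : Finset ι) (a a' b b' : ι → V)
    (hab : ∀ j ∈ J, a j ≠ b j) (hab' : ∀ j ∈ J, a j ≠ b' j) (ha'b' : ∀ j ∈ J, a' j ≠ b' j)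
    {i : ι} (hi : i ∈ J) (haa : a i ≠ a' i) (hbb : b i ≠ b' i) :
    (∏ j ∈ J, (X (j, a j) - X (j, b j) : MvPolynomial (ι × V) ℚ)) *
        ∏ j ∈ J, (X (j, a' j) - X (j, b' j)) -
      (∏ j ∈ J, (X (j, a j) - X (j, b' j))) * ∏ j ∈ J, (X (j, a' j) - X (j, b j)) ≠ 0 := by
  intro h
  -- Identifying these two variables kills the second product of the minor; `haa` and `hbb` keep the
  -- first one nonzero.
  let ρ : ι × V → ι × V := fun p => if p = (i, b' i) then (i, a i) else p
  have h' := congrArg (rename ρ) h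
  simp only [map_sub, map_mul, map_prod, rename_X, map_zero] at h'
  have hz : ∏ j ∈ J, (X (ρ (j, a j)) - X (ρ (j, b' j)) : MvPolynomial (ι × V) ℚ) = 0 :=
    Finset.prod_eq_zero hi (by simp [ρ])
  rw [hz, zero_mul, sub_zero, mul_eq_zero, Finset.prod_eq_zero_iff, Finset.prod_eq_zero_iff] at h'
  have inj : ∀ p q : ι × V, (X p - X q : MvPolynomial (ι × V) ℚ) = 0 → p = q :=
    fun p q hpq => X_injective (sub_eq_zero.1 hpq)
  rcases h' with ⟨j, hj, hz⟩ | ⟨j, hj, hz⟩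
  · have := inj _ _ hz
    simp only [ρ] at this
    grind
  · have := inj _ _ hz
    simp only [ρ] at this
    grind

end GenericPoints

/-! ### Structure of a pair of families without a small cover. -/

namespace CrossMatching

open Finset

variable {ι V : Type*}

/-- Every vector of `P` has one of its entries in `T`. -/
def IsCover (T : Finset (ι × V)) (P : Finset (ι → V)) : Prop :=
  ∀ p ∈ P, ∃ i, (i, p i) ∈ T

section Entries

variable [DecidableEq ι] [DecidableEq V]

/-- The entries of `p` at the coordinates in `S`. -/
def entries (p : ι → V) (S : Finset ι) : Finset (ι × V) := S.image fun i => (i, p i)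

theorem mem_entries {p : ι → V} {S : Finset ι} {i : ι} {v : V} :
    (i, v) ∈ entries p S ↔ i ∈ S ∧ p i = v := by
  simp [entries]

end Entries

/-- Two nonempty families such that every vector of one agrees somewhere with every vector of
the other, and which have no common cover by at most `2 * card ι - 2` entries. -/
structure Uncoverable [Fintype ι] (P Q : Finset (ι → V)) : Prop where
  left_nonempty : P.Nonempty
  right_nonempty : Q.Nonempty
  cross : ∀ a ∈ P, ∀ b ∈ Q, ∃ i, a i = b i
  large : ∀ T : Finset (ι × V), IsCover T P → IsCover T Q → 2 * Fintype.card ι - 2 < #T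

variable [Fintype ι] {P Q : Finset (ι → V)}

theorem Uncoverable.symm (h : Uncoverable P Q) : Uncoverable Q P where
  left_nonempty := h.right_nonempty
  right_nonempty := h.left_nonempty
  cross a ha b hb := (h.cross b hb a ha).imp fun _ => Eq.symm
  large T hP hQ := h.large T hQ hP

variable [DecidableEq V]

/-- The vectors of `Q` that disagree everywhere with all the others. -/
def isolated (Q : Finset (ι → V)) : Finset (ι → V) :=
  {b ∈ Q | ∀ b' ∈ Q, b' ≠ b → ∀ k, b' k ≠ b k}

theorem mem_isolated {b : ι → V} :
    b ∈ isolated Q ↔ b ∈ Q ∧ ∀ b' ∈ Q, b' ≠ b → ∀ k, b' k ≠ b k := by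
  simp [isolated]

theorem eq_of_mem_isolated {b b' : ι → V} (hb : b ∈ isolated Q) (hb' : b' ∈ Q) {k : ι}
    (hk : b' k = b k) : b' = b := by
  by_contra hne
  exact (mem_isolated.1 hb).2 b' hb' hne k hk

/-- Each vector of `P` uses one coordinate for each isolated vector of `Q`. -/
theorem Uncoverable.exists_injOn_isolated (h : Uncoverable P Q) {a : ι → V} (ha : a ∈ P) :
    ∃ π : (ι → V) → ι, (∀ b ∈ Q, a (π b) = b (π b)) ∧ Set.InjOn π (isolated Q) := by
  obtain ⟨b, hb⟩ := h.right_nonempty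
  have : Nonempty ι := (h.cross a ha b hb).nonempty
  choose! π hπ using h.cross a ha
  refine ⟨π, hπ, fun b hb b' hb' e => ?_⟩
  have hb'Q := (mem_isolated.1 hb').1
  refine eq_of_mem_isolated hb' (mem_isolated.1 hb).1 (k := π b') ?_
  rw [← hπ b' hb'Q, ← e]
  exact (hπ b (mem_isolated.1 hb).1).symm

theorem Uncoverable.card_isolated_le (h : Uncoverable P Q) :
    #(isolated Q) ≤ Fintype.card ι := by
  obtain ⟨a, ha⟩ := h.left_nonempty
  obtain ⟨π, -, hinj⟩ := h.exists_injOn_isolated ha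
  exact card_le_card_of_injOn π (fun _ _ => mem_univ _) hinj

variable [DecidableEq ι]

/-- The working form of `large`: the structural lemmas below arise from choices of `S` and `S'`. -/
theorem Uncoverable.exists_not_covered (h : Uncoverable P Q) (a b : ι → V) (S S' : Finset ι)
    (hS : #S + #S' ≤ 2 * Fintype.card ι - 2) :
    (∃ a' ∈ P, (∀ k ∈ S, a' k ≠ a k) ∧ ∀ k ∈ S', a' k ≠ b k) ∨
      ∃ b' ∈ Q, (∀ k ∈ S, b' k ≠ a k) ∧ ∀ k ∈ S', b' k ≠ b k := by
  by_contra! hc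
  refine absurd (h.large (entries a S ∪ entries b S') ?_ ?_) (not_lt.2 ?_)
  · intro p hp
    by_contra! hn
    simp only [mem_union, mem_entries, not_or, not_and] at hn
    obtain ⟨k, hk, hk'⟩ := hc.1 p hp fun k hk e => (hn k).1 hk e.symm
    exact (hn k).2 hk hk'.symm
  · intro p hp
    by_contra! hn
    simp only [mem_union, mem_entries, not_or, not_and] at hn
    obtain ⟨k, hk, hk'⟩ := hc.2 p hp fun k hk e => (hn k).1 hk e.symm
    exact (hn k).2 hk hk'.symm
  · exact (card_union_le _ _).trans ((add_le_add card_image_le card_image_le).trans hS)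

theorem Uncoverable.exact (h : Uncoverable P Q) {a b : ι → V} (ha : a ∈ P) (hb : b ∈ Q) {i j : ι}
    (hi : a i = b i) (hj : a j = b j) : i = j := by
  by_contra hij
  -- Two shared entries would leave only 2r-2 distinct entries in `a` and `b` together, and these
  -- cover both families.
  have hc : #(univ : Finset ι) + #((univ.erase i).erase j) ≤ 2 * Fintype.card ι - 2 := by
    rw [card_erase_of_mem (by simp [Ne.symm hij]), card_erase_of_mem (mem_univ _), card_univ]
    have := Fintype.one_lt_card_iff.2 ⟨i, j, hij⟩
    omega
  rcases h.exists_not_covered a b _ _ hc with ⟨a', ha', h1, h2⟩ | ⟨b', hb', h1, -⟩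
  · obtain ⟨k, hk⟩ := h.cross a' ha' b hb
    have := h1 k (mem_univ _)
    by_cases hki : k = i
    · subst hki; exact this (hk.trans hi.symm)
    by_cases hkj : k = j
    · subst hkj; exact this (hk.trans hj.symm)
    exact h2 k (by simp [hki, hkj]) hk
  · obtain ⟨k, hk⟩ := h.cross a ha b' hb'
    exact h1 k (mem_univ _) hk.symm

theorem Uncoverable.exists_right_eq (h : Uncoverable P Q) {a : ι → V} (ha : a ∈ P) (i : ι) :
    ∃ b ∈ Q, b i = a i := by
  by_contra! hn
  obtain ⟨b, hb⟩ := h.right_nonempty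
  obtain ⟨j, hj⟩ := h.cross a ha b hb
  have hji : j ≠ i := by rintro rfl; exact hn b hb hj.symm
  -- The entry `a i` meets no vector of `Q`, and the entry at `j` is shared, so one copy of it
  -- suffices.
  have hc : #(univ.erase i) + #(univ.erase j) ≤ 2 * Fintype.card ι - 2 := by
    rw [card_erase_of_mem (mem_univ _), card_erase_of_mem (mem_univ _), card_univ]
    omega
  rcases h.exists_not_covered a b _ _ hc with ⟨a', ha', h1, h2⟩ | ⟨b', hb', h1, -⟩
  · obtain ⟨k, hk⟩ := h.cross a' ha' b hb
    by_cases hkj : k = j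
    · subst hkj; exact h1 k (by simp [hji]) (hk.trans hj.symm)
    · exact h2 k (by simp [hkj]) hk
  · obtain ⟨k, hk⟩ := h.cross a ha b' hb'
    refine h1 k (mem_erase.2 ⟨?_, mem_univ _⟩) hk.symm
    rintro rfl
    exact hn b' hb' hk.symm

theorem Uncoverable.exists_disjoint (h : Uncoverable P Q) {a b : ι → V} (ha : a ∈ P) (hb : b ∈ Q)
    {j : ι} (hj : b j ≠ a j) : ∃ a' ∈ P, a' j = b j ∧ ∀ k, a' k ≠ a k := by
  obtain ⟨i, hi⟩ := h.cross a ha b hb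
  have hij : j ≠ i := by rintro rfl; exact hj hi.symm
  -- Dropping the shared entry at `i` and that of `b` at `j` leaves an uncovered vector able to meet
  -- `b` only at `j`.
  have hc : #(univ : Finset ι) + #((univ.erase i).erase j) ≤ 2 * Fintype.card ι - 2 := by
    rw [card_erase_of_mem (by simp [hij]), card_erase_of_mem (mem_univ _), card_univ]
    have := Fintype.one_lt_card_iff.2 ⟨j, i, hij⟩
    omega
  rcases h.exists_not_covered a b _ _ hc with ⟨a', ha', h1, h2⟩ | ⟨b', hb', h1, -⟩
  · obtain ⟨k, hk⟩ := h.cross a' ha' b hb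
    refine ⟨a', ha', ?_, fun k => h1 k (mem_univ _)⟩
    by_cases hkj : k = j
    · rwa [hkj] at hk
    by_cases hki : k = i
    · subst hki; exact absurd (hk.trans hi.symm) (h1 k (mem_univ _))
    exact absurd hk (h2 k (by simp [hki, hkj]))
  · obtain ⟨k, hk⟩ := h.cross a ha b' hb'
    exact absurd hk.symm (h1 k (mem_univ _))

theorem Uncoverable.exists_twin (h : Uncoverable P Q) {a b : ι → V} (ha : a ∈ P) (hb : b ∈ Q)
    {i : ι} (hi : a i = b i) :
    (∃ a' ∈ P, a' i = a i ∧ ∀ k, k ≠ i → a' k ≠ a k) ∨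
      ∃ b' ∈ Q, b' i = b i ∧ ∀ k, k ≠ i → b' k ≠ b k := by
  have hc : #(univ.erase i) + #(univ.erase i) ≤ 2 * Fintype.card ι - 2 := by
    rw [card_erase_of_mem (mem_univ _), card_univ]
    omega
  rcases h.exists_not_covered a b _ _ hc with ⟨a', ha', h1, h2⟩ | ⟨b', hb', h1, h2⟩
  · left
    obtain ⟨k, hk⟩ := h.cross a' ha' b hb
    have hki : k = i := by
      by_contra hki
      exact h2 k (by simp [hki]) hk
    subst hki
    exact ⟨a', ha', hk.trans hi.symm, fun l hl => h1 l (by simp [hl])⟩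
  · right
    obtain ⟨k, hk⟩ := h.cross a ha b' hb'
    have hki : k = i := by
      by_contra hki
      exact h1 k (by simp [hki]) hk.symm
    subst hki
    exact ⟨b', hb', hk.symm.trans hi, fun l hl => h2 l (by simp [hl])⟩

/-- `exists_disjoint` supplies, for any other `b'`, a vector of `Q` with the value `b i` that avoids
`b'` everywhere; by uniqueness it is `b`. -/
theorem Uncoverable.mem_isolated_right (h : Uncoverable P Q) {b : ι → V} (hb : b ∈ Q) {i : ι}
    (hu : ∀ b' ∈ Q, b' i = b i → b' = b) : b ∈ isolated Q := by
  refine mem_isolated.2 ⟨hb, fun b' hb' hne k => ?_⟩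
  obtain ⟨a, ha, hai⟩ := h.symm.exists_right_eq hb i
  have : a i ≠ b' i := fun e => hne (hu b' hb' (e.symm.trans hai))
  obtain ⟨b'', hb'', hi, hd⟩ := h.symm.exists_disjoint hb' ha this
  rw [hu b'' hb'' (hi.trans hai)] at hd
  exact (hd k).symm

theorem Uncoverable.exists_twin_of_isolated [Nontrivial ι] (h : Uncoverable P Q) {a b : ι → V}
    (ha : a ∈ P) (hb : b ∈ isolated Q) {i : ι} (hi : a i = b i) :
    ∃ a' ∈ P, a' i = a i ∧ ∀ k, k ≠ i → a' k ≠ a k := by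
  refine (h.exists_twin ha (mem_isolated.1 hb).1 hi).resolve_right ?_
  rintro ⟨b', hb', hi', hk⟩
  obtain ⟨k, hki⟩ := exists_ne i
  exact hk k hki (by rw [eq_of_mem_isolated hb hb' hi'])

theorem Uncoverable.isolated_eq_empty [Nontrivial ι] (h : Uncoverable P Q)
    (hQ : (isolated Q).Nonempty) : isolated P = ∅ := by
  rw [eq_empty_iff_forall_notMem]
  intro a ha
  obtain ⟨b, hb⟩ := hQ
  obtain ⟨i, hi⟩ := h.cross a (mem_isolated.1 ha).1 b (mem_isolated.1 hb).1
  obtain ⟨a', ha', hi', hk⟩ := h.exists_twin_of_isolated (mem_isolated.1 ha).1 hb hi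
  obtain ⟨k, hki⟩ := exists_ne i
  exact hk k hki (by rw [eq_of_mem_isolated ha ha' hi'])

/-- Yields either isolation or the data for a nonzero 2 × 2 minor. A twin differs at every
coordinate other than `i`, so `j` need only be chosen for the opposite pair. -/
theorem Uncoverable.isolated_or_exists_cross [Nontrivial ι] (h : Uncoverable P Q)
    {a b : ι → V} (ha : a ∈ P) (hb : b ∈ Q) {i : ι} (hi : a i = b i) :
    a ∈ isolated P ∨ b ∈ isolated Q ∨
      ∃ a' ∈ P, ∃ b' ∈ Q, a' i = b i ∧ b' i = b i ∧ ∃ j ≠ i, a j ≠ a' j ∧ b j ≠ b' j := by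
  rcases h.exists_twin ha hb hi with ⟨a', ha', hi', hk⟩ | ⟨b', hb', hi', hk⟩
  · by_cases hu : ∀ b' ∈ Q, b' i = b i → b' = b
    · exact Or.inr (Or.inl (h.mem_isolated_right hb hu))
    push Not at hu
    obtain ⟨b', hb', hbi, hne⟩ := hu
    obtain ⟨j, hj⟩ := Function.ne_iff.1 hne
    have hji : j ≠ i := by rintro rfl; exact hj hbi
    exact Or.inr (Or.inr ⟨a', ha', b', hb', hi'.trans hi, hbi, j, hji, (hk j hji).symm, hj.symm⟩)
  · by_cases hu : ∀ a' ∈ P, a' i = a i → a' = a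
    · exact Or.inl (h.symm.mem_isolated_right ha hu)
    push Not at hu
    obtain ⟨a', ha', hai, hne⟩ := hu
    obtain ⟨j, hj⟩ := Function.ne_iff.1 hne
    have hji : j ≠ i := by rintro rfl; exact hj hai
    exact Or.inr (Or.inr ⟨a', ha', b', hb', hai.trans hi, hi', j, hji, hj.symm, (hk j hji).symm⟩)

theorem Uncoverable.two_mul_sub_one_le_card_image (h : Uncoverable P Q) (i : ι) :
    2 * Fintype.card ι - 1 ≤ #(Q.image (· i)) := by
  have := h.large ((Q.image (· i)).image fun v => (i, v)) ?_ ?_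
  · rw [card_image_of_injective _ (fun v w e => (Prod.mk.inj e).2)] at this
    omega
  · intro a ha
    obtain ⟨b, hb, hba⟩ := h.exists_right_eq ha i
    exact ⟨i, mem_image.2 ⟨a i, mem_image.2 ⟨b, hb, hba⟩, rfl⟩⟩
  · exact fun b hb => ⟨i, mem_image.2 ⟨b i, mem_image_of_mem (· i) hb, rfl⟩⟩

end CrossMatching

/-! ### Rank of the pairing matrix and the numerical contradiction. -/

namespace CrossMatching

open Finset

variable {ι V : Type*}

/-- The vector `a` with each of its entries replaced by an indeterminate of its own. -/
noncomputable def genericPoint (a : ι → V) : ι → FractionRing (MvPolynomial (ι × V) ℚ) :=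
  fun j => algebraMap (MvPolynomial (ι × V) ℚ) _ (MvPolynomial.X (j, a j))

theorem genericPoint_inj {a b : ι → V} {j : ι} :
    genericPoint a j = genericPoint b j ↔ a j = b j := by
  constructor
  · intro h
    have := MvPolynomial.X_injective (IsFractionRing.injective (MvPolynomial (ι × V) ℚ) _ h)
    exact (Prod.mk.inj this).2
  · intro h
    simp only [genericPoint, h]

variable [Fintype ι] [DecidableEq ι]

/-- The product of the differences of two generic points, leaving out the coordinate `i`. -/
noncomputable def pairing (i : ι) (a b : ι → V) : FractionRing (MvPolynomial (ι × V) ℚ) :=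
  ∏ j ∈ univ.erase i, (genericPoint a j - genericPoint b j)

theorem pairing_eq_zero_iff {i : ι} {a b : ι → V} :
    pairing i a b = 0 ↔ ∃ j ≠ i, a j = b j := by
  simp [pairing, Finset.prod_eq_zero_iff, sub_eq_zero, genericPoint_inj]

variable {P Q : Finset (ι → V)}

theorem Uncoverable.pairing_eq_zero (h : Uncoverable P Q) {a b : ι → V} (ha : a ∈ P) (hb : b ∈ Q)
    {i : ι} (hi : a i ≠ b i) : pairing i a b = 0 := by
  obtain ⟨j, hj⟩ := h.cross a ha b hb
  exact pairing_eq_zero_iff.2 ⟨j, by rintro rfl; exact hi hj, hj⟩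

theorem card_le_of_separated {i : ι} {D : Finset (ι → V)}
    (hD : ∀ c : (ι → V) → FractionRing (MvPolynomial (ι × V) ℚ),
      (∀ a ∈ P, ∑ b ∈ D, c b * pairing i a b = 0) → ∀ b ∈ D, c b = 0) :
    #D ≤ 2 ^ (Fintype.card ι - 1) := by
  have := card_le_two_pow_of_separated (univ.erase i) D genericPoint (genericPoint '' (P : Set _))
    fun c hc => hD c fun a ha => hc _ ⟨a, ha, rfl⟩
  rwa [card_erase_of_mem (mem_univ _), card_univ] at this

variable [DecidableEq V]

theorem pairing_minor_ne_zero {i : ι} {a a' b b' : ι → V} (hab : pairing i a b ≠ 0)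
    (hab' : pairing i a b' ≠ 0) (hab'' : pairing i a' b' ≠ 0) {j : ι} (hj : j ≠ i)
    (haa : a j ≠ a' j) (hbb : b j ≠ b' j) :
    pairing i a b * pairing i a' b' - pairing i a b' * pairing i a' b ≠ 0 := by
  rw [Ne, pairing_eq_zero_iff] at hab hab' hab''
  push Not at hab hab' hab''
  have key := MvPolynomial.prod_X_sub_X_minor_ne_zero (univ.erase i) a a' b b'
    (fun k hk => hab k (ne_of_mem_erase hk)) (fun k hk => hab' k (ne_of_mem_erase hk))
    (fun k hk => hab'' k (ne_of_mem_erase hk)) (i := j) (by simp [hj]) haa hbb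
  intro h0
  apply key
  apply IsFractionRing.injective (MvPolynomial (ι × V) ℚ) (FractionRing (MvPolynomial (ι × V) ℚ))
  simpa [pairing, genericPoint] using h0

theorem Uncoverable.pairing_ne_zero (h : Uncoverable P Q) {a b : ι → V} (ha : a ∈ P) (hb : b ∈ Q)
    {i : ι} (hi : a i = b i) : pairing i a b ≠ 0 := by
  rw [Ne, pairing_eq_zero_iff]
  rintro ⟨j, hj, e⟩
  exact hj (h.exact ha hb e hi)

variable [Nontrivial ι]

theorem Uncoverable.exists_separated_in_fiber (h : Uncoverable P Q) (hP : isolated P = ∅) (i : ι)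
    {v : V} (hv : v ∈ Q.image (· i)) :
    ∃ D ⊆ Q, (∀ b ∈ D, b i = v) ∧ (2 ≤ #D ∨ 1 ≤ #D ∧ ∃ b ∈ isolated Q, b i = v) ∧
      ∀ c : (ι → V) → FractionRing (MvPolynomial (ι × V) ℚ),
        (∀ a ∈ P, a i = v → ∑ b ∈ D, c b * pairing i a b = 0) → ∀ b ∈ D, c b = 0 := by
  obtain ⟨b, hb, rfl⟩ := mem_image.1 hv
  obtain ⟨a, ha, hi⟩ := h.symm.exists_right_eq hb i
  rcases h.isolated_or_exists_cross ha hb hi with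
    ha' | hb' | ⟨a', ha', b', hb', hai, hbi, j, hj, haa, hbb⟩
  · simp [hP] at ha'
  · refine ⟨{b}, by simpa using hb, by simp, Or.inr ⟨by simp, b, hb', rfl⟩, fun c hc => ?_⟩
    have := hc a ha hi
    rw [sum_singleton] at this
    simpa using (mul_eq_zero.1 this).resolve_right (h.pairing_ne_zero ha hb hi)
  · have hne : b ≠ b' := fun e => hbb (by rw [e])
    refine ⟨{b, b'}, by simp [insert_subset_iff, hb, hb'], by simp [hbi],
      Or.inl (card_pair hne).ge, fun c hc => ?_⟩
    have h1 := hc a ha hi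
    have h2 := hc a' ha' hai
    rw [sum_pair hne] at h1 h2
    have hdet := pairing_minor_ne_zero (h.pairing_ne_zero ha hb hi)
      (h.pairing_ne_zero ha hb' (hi.trans hbi.symm))
      (h.pairing_ne_zero ha' hb' (hai.trans hbi.symm)) hj haa hbb
    have hcb : c b = 0 := by
      refine (mul_eq_zero.1 ?_).resolve_right hdet
      linear_combination pairing i a' b' * h1 - pairing i a b' * h2
    have hcb' : c b' = 0 := by
      refine (mul_eq_zero.1 ?_).resolve_right hdet
      linear_combination pairing i a b * h2 - pairing i a' b * h1
    simp [hcb, hcb']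

/-- Within `Q` there is a family, with at least two members for each entry at `i` that is not
the entry of an isolated vector, on which the functions `pairing i a` for `a ∈ P` separate all
linear combinations. -/
theorem Uncoverable.exists_separated (h : Uncoverable P Q) (hP : isolated P = ∅) (i : ι) :
    ∃ D ⊆ Q, 2 * #(Q.image (· i)) ≤ #D + #(isolated Q) ∧
      ∀ c : (ι → V) → FractionRing (MvPolynomial (ι × V) ℚ),
        (∀ a ∈ P, ∑ b ∈ D, c b * pairing i a b = 0) → ∀ b ∈ D, c b = 0 := by
  choose! F hFQ hFi hFc hFs using fun v (hv : v ∈ Q.image (· i)) =>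
    h.exists_separated_in_fiber hP i hv
  set W := Q.image (· i)
  have hfib : ∀ v ∈ W, {b ∈ W.biUnion F | b i = v} = F v := by
    intro v hv
    ext b
    simp only [mem_filter, mem_biUnion]
    constructor
    · rintro ⟨⟨w, hw, hb⟩, rfl⟩
      rwa [hFi w hw b hb]
    · exact fun hb => ⟨⟨v, hv, hb⟩, hFi v hv b hb⟩
  have hmaps : ∀ b ∈ W.biUnion F, b i ∈ W := by
    intro b hb
    obtain ⟨w, hw, hb⟩ := mem_biUnion.1 hb
    rwa [hFi w hw b hb]
  refine ⟨W.biUnion F, biUnion_subset.2 hFQ, ?_, ?_⟩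
  · rw [card_eq_sum_card_fiberwise (s := W.biUnion F) (f := fun b => b i) (t := W)
        (fun b hb => hmaps b hb),
      card_eq_sum_card_fiberwise (s := isolated Q) (f := fun b => b i) (t := W)
        (fun b hb => mem_image_of_mem (· i) (mem_isolated.1 hb).1),
      ← sum_add_distrib, mul_comm, ← smul_eq_mul]
    refine card_nsmul_le_sum _ _ _ fun v hv => ?_
    rw [hfib v hv]
    rcases hFc v hv with h2 | ⟨h1, b, hb, hbi⟩
    · omega
    · have : 1 ≤ #{b ∈ isolated Q | b i = v} := card_pos.2 ⟨b, by simp [hb, hbi]⟩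
      omega
  · intro c hc b hb
    refine hFs (b i) (hmaps b hb) c (fun a ha hai => ?_) b ?_
    -- Block diagonality: terms outside the fibre of `a i` vanish.
    · rw [← hfib _ (hmaps b hb), ← hc a ha]
      refine sum_subset (filter_subset _ _) fun b' hb' hn => ?_
      rw [h.pairing_eq_zero ha (biUnion_subset.2 hFQ hb'), mul_zero]
      intro e
      exact hn (mem_filter.2 ⟨hb', e.symm.trans hai⟩)
    · rw [← hfib _ (hmaps b hb)]
      exact mem_filter.2 ⟨hb, rfl⟩

/-- Two twins in `P` through the entry of `b` at `i` pair to zero with every other vector of `Q`, so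
their rows are proportional. At equality the twins would then agree off `i`. -/
theorem Uncoverable.card_lt_of_separated (h : Uncoverable P Q) {i : ι} {D : Finset (ι → V)}
    (hDQ : D ⊆ Q)
    (hD : ∀ c : (ι → V) → FractionRing (MvPolynomial (ι × V) ℚ),
      (∀ a ∈ P, ∑ b ∈ D, c b * pairing i a b = 0) → ∀ b ∈ D, c b = 0)
    {b : ι → V} (hb : b ∈ isolated Q) : #D < 2 ^ (Fintype.card ι - 1) := by
  refine lt_of_le_of_ne (card_le_of_separated hD) fun hcard => ?_
  obtain ⟨a, ha, hi⟩ := h.symm.exists_right_eq (mem_isolated.1 hb).1 i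
  obtain ⟨a', ha', hi', hne⟩ := h.exists_twin_of_isolated ha hb hi
  have key := eq_of_proportional_of_card_eq (univ.erase i) D genericPoint
    (genericPoint '' (P : Set _)) (fun c hc => hD c fun a ha => hc _ ⟨a, ha, rfl⟩)
    (by rwa [card_erase_of_mem (mem_univ _), card_univ])
    (x := genericPoint a) (x' := genericPoint a') (e := pairing i a' b) (e' := pairing i a b)
    (h.pairing_ne_zero ha' (mem_isolated.1 hb).1 (hi'.trans hi)) ?_
  · obtain ⟨k, hk⟩ := exists_ne i
    exact hne k hk (genericPoint_inj.1 (key k (by simp [hk]))).symm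
  · intro b' hb'
    change _ * pairing i a b' = _ * pairing i a' b'
    by_cases e : b' = b
    · rw [e, mul_comm]
    · have : b i ≠ b' i := fun e' => e (eq_of_mem_isolated hb (hDQ hb') e'.symm)
      rw [h.pairing_eq_zero ha (hDQ hb') (by rwa [hi]),
        h.pairing_eq_zero ha' (hDQ hb') (by rwa [hi', hi]), mul_zero, mul_zero]

/-- If q ≥ r-2, a vector of `P` meeting a non-isolated one at `j` spends q other coordinates on
isolated vectors, so at most one coordinate `k` besides `j` remains for the non-isolated ones. -/
theorem Uncoverable.card_isolated_add_two_lt (h : Uncoverable P Q) (hι : 3 ≤ Fintype.card ι) :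
    #(isolated Q) + 2 < Fintype.card ι := by
  by_contra! hc
  have hq := h.card_isolated_le
  obtain ⟨j⟩ : Nonempty ι := inferInstance
  set W := (Q \ isolated Q).image (· j) with hWdef
  have hW : 2 * Fintype.card ι - 1 ≤ #W + #(isolated Q) := by
    refine (h.two_mul_sub_one_le_card_image j).trans ?_
    have : Q.image (· j) ⊆ W ∪ (isolated Q).image (· j) := by
      rw [hWdef, ← image_union]
      exact image_subset_image (by simp)
    exact (card_le_card this).trans
      ((card_union_le _ _).trans (Nat.add_le_add_left card_image_le _))
  have avoid : ∀ {a b b' : ι → V} {k : ι}, b ∈ Q \ isolated Q → b' ∈ isolated Q →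
      a k = b k → a k = b' k → False := by
    intro a b b' k hb hb' e e'
    rw [mem_sdiff] at hb
    rw [eq_of_mem_isolated hb' hb.1 (e.symm.trans e')] at hb
    exact hb.2 hb'
  have hmaps : ∀ {a b : ι → V} {π : (ι → V) → ι}, (∀ b ∈ Q, a (π b) = b (π b)) →
      b ∈ Q \ isolated Q → a j = b j → ∀ b' ∈ isolated Q, π b' ∈ univ.erase j := by
    intro a b π hπ hb hab b' hb'
    refine mem_erase.2 ⟨fun e => ?_, mem_univ _⟩
    have := hπ b' (mem_isolated.1 hb').1
    rw [e] at this
    exact avoid hb hb' hab this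
  have hq' : #(isolated Q) ≤ Fintype.card ι - 1 := by
    obtain ⟨v, hv⟩ : W.Nonempty := by rw [← card_pos]; omega
    obtain ⟨b, hb, rfl⟩ := mem_image.1 hv
    obtain ⟨a, ha, haj⟩ := h.symm.exists_right_eq (mem_sdiff.1 hb).1 j
    obtain ⟨π, hπ, hinj⟩ := h.exists_injOn_isolated ha
    simpa using card_le_card_of_injOn (t := univ.erase j) π (hmaps hπ hb haj) hinj
  have hrest : ∀ v ∈ W, ∃ k ∈ univ.erase j, ∃ a ∈ P, a j = v ∧
      ∀ b ∈ Q \ isolated Q, a j = b j ∨ a k = b k := by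
    intro v hv
    obtain ⟨b, hb, rfl⟩ := mem_image.1 hv
    obtain ⟨a, ha, haj⟩ := h.symm.exists_right_eq (mem_sdiff.1 hb).1 j
    obtain ⟨π, hπ, hinj⟩ := h.exists_injOn_isolated ha
    have hcard : #(univ.erase j \ (isolated Q).image π) ≤ 1 := by
      rw [card_sdiff_of_subset, card_image_of_injOn hinj, card_erase_of_mem (mem_univ _), card_univ]
      · omega
      · exact image_subset_iff.2 (hmaps hπ hb haj)
    obtain ⟨k, hk, hsub⟩ : ∃ k ∈ univ.erase j, univ.erase j \ (isolated Q).image π ⊆ {k} := by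
      rcases (univ.erase j \ (isolated Q).image π).eq_empty_or_nonempty with he | ⟨k, hk⟩
      · obtain ⟨k, hk⟩ := exists_ne j
        exact ⟨k, by simp [hk], by simp [he]⟩
      · exact ⟨k, (mem_sdiff.1 hk).1, fun l hl => mem_singleton.2 (card_le_one.1 hcard l hl k hk)⟩
    refine ⟨k, hk, a, ha, haj, fun b' hb' => ?_⟩
    have hb'π := hπ b' (mem_sdiff.1 hb').1
    by_cases hj : π b' = j
    · exact Or.inl (hj ▸ hb'π)
    · right
      have : π b' ∈ univ.erase j \ (isolated Q).image π := by
        refine mem_sdiff.2 ⟨by simp [hj], fun hmem => ?_⟩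
        obtain ⟨b'', hb'', e⟩ := mem_image.1 hmem
        have := hπ b'' (mem_isolated.1 hb'').1
        rw [e] at this
        exact avoid hb' hb'' hb'π this
      rwa [mem_singleton.1 (hsub this)] at hb'π
  choose! κ hκ α hα hαj hαQ using hrest
  -- By `hW` and `hq'`, `W` has at least r values, while `κ` takes at most r-1.
  obtain ⟨v, hv, v', hv', hvv, hκκ⟩ := exists_ne_map_eq_of_card_lt_of_maps_to
    (s := W) (t := univ.erase j) (f := κ)
    (by rw [card_erase_of_mem (mem_univ _), card_univ]; omega) hκ
  -- A third value would make `α v` and `α v'` agree at `k`, so `α v` would agree with `b₀` at both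
  -- `j` and `k`.
  have hsub : W ⊆ {v, v'} := by
    intro w hw
    obtain ⟨b, hb, rfl⟩ := mem_image.1 hw
    by_contra hn
    simp only [mem_insert, mem_singleton, not_or] at hn
    have h1 := (hαQ v hv b hb).resolve_left fun e => hn.1 (e.symm.trans (hαj v hv))
    have h2 := (hαQ v' hv' b hb).resolve_left fun e => hn.2 (e.symm.trans (hαj v' hv'))
    obtain ⟨b₀, hb₀, hb₀j⟩ := mem_image.1 hv
    have h3 := (hαQ v' hv' b₀ hb₀).resolve_left fun e =>
      hvv (hb₀j.symm.trans (e.symm.trans (hαj v' hv')))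
    rw [hκκ] at h1
    refine ne_of_mem_erase (hκ v' hv') (h.exact (hα v hv) (mem_sdiff.1 hb₀).1
      (h1.trans (h2.symm.trans h3)) ((hαj v hv).trans hb₀j.symm))
  have := (card_le_card hsub).trans card_le_two
  omega

theorem Uncoverable.six_le_card_of_isolated_eq_empty (h : Uncoverable P Q)
    (hP : isolated P = ∅) : 6 ≤ Fintype.card ι := by
  obtain ⟨i⟩ : Nonempty ι := inferInstance
  obtain ⟨D, hDQ, hcard, hD⟩ := h.exists_separated hP i
  have ht := h.two_mul_sub_one_le_card_image i
  have hq := h.card_isolated_le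
  have hD1 := card_le_of_separated hD
  have htwo : 1 < Fintype.card ι := Fintype.one_lt_card
  by_contra! hlt
  generalize hr : Fintype.card ι = r at *
  interval_cases r
  · omega
  · omega
  · omega
  -- For r = 5: 18 ≤ `#D` + q with q ≤ 2 and, since q > 0, `#D` ≤ 15.
  · have hq2 := h.card_isolated_add_two_lt (by omega)
    obtain ⟨b, hb⟩ : (isolated Q).Nonempty := by rw [← card_pos]; omega
    have := h.card_lt_of_separated hDQ hD hb
    rw [hr] at this hq2
    omega

/-- Two cross-agreeing families with at most five coordinates have a common cover by
`2 * card ι - 2` entries. -/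
theorem exists_cover (hι : Fintype.card ι ≤ 5) (hP : P.Nonempty) (hQ : Q.Nonempty)
    (hcross : ∀ a ∈ P, ∀ b ∈ Q, ∃ i, a i = b i) :
    ∃ T : Finset (ι × V), #T ≤ 2 * Fintype.card ι - 2 ∧ IsCover T P ∧ IsCover T Q := by
  by_contra! hn
  have h : Uncoverable P Q :=
    ⟨hP, hQ, hcross, fun T h1 h2 => not_le.1 fun hT => hn T hT h1 h2⟩
  have : 6 ≤ Fintype.card ι := by
    rcases (isolated Q).eq_empty_or_nonempty with he | hne
    · exact h.symm.six_le_card_of_isolated_eq_empty he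
    · exact h.six_le_card_of_isolated_eq_empty (h.isolated_eq_empty hne)
  omega

end CrossMatching

/-! ### From entries to monochromatic components. -/

namespace SimpleGraph.EdgeLabeling

variable {V : Type*} {G : SimpleGraph V} {K : Type*} {C : G.EdgeLabeling K}

theorem labelGraph_adj_of_adj {x y : V} (h : G.Adj x y) :
    (C.labelGraph (C ⟨s(x, y), h⟩)).Adj x y :=
  labelGraph_adj x y |>.2 ⟨h, rfl⟩

theorem supp_nontrivial_of_adj {k : K} {x y : V} (h : (C.labelGraph k).Adj x y) :
    ((C.labelGraph k).connectedComponentMk x).supp.Nontrivial :=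
  ⟨x, rfl, y, ConnectedComponent.sound h.symm.reachable, h.ne⟩

/-- If `x` is not isolated in `G`, then its component in any colour lies in a monochromatic
component. -/
theorem exists_supp_subset_verts {x y : V} (h : G.Adj x y) (k : K) :
    ∃ M : C.MonochromaticComponent,
      ((C.labelGraph k).connectedComponentMk x).supp ⊆ M.verts := by
  by_cases hk : ((C.labelGraph k).connectedComponentMk x).supp.Nontrivial
  · exact ⟨⟨k, _, hk⟩, subset_rfl⟩
  -- A one-vertex component is replaced by the component of the edge `xy` in its own colour.
  · refine ⟨⟨_, _, supp_nontrivial_of_adj (labelGraph_adj_of_adj h)⟩, fun z hz => ?_⟩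
    rw [Set.not_nontrivial_iff] at hk
    rw [hk hz (show x ∈ _ from rfl)]
    exact rfl

end SimpleGraph.EdgeLabeling

theorem theorem1p5 (r : ℕ) (hr : r = 2 ∨ r = 3 ∨ r = 4 ∨ r = 5)
    (A : Type*) (B : Type*) [Finite A] [Finite B] [Nonempty A] [Nonempty B]
    (C : (completeBipartiteGraph A B).EdgeLabeling (Fin r)) :
    C.CoverableBy (2 * r - 2) := by
  classical
  have := Fintype.ofFinite A
  have := Fintype.ofFinite B
  have : Nontrivial (Fin r) := Fin.nontrivial_iff_two_le.2 (by omega)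
  let comp (v : A ⊕ B) (i : Fin r) : Set (A ⊕ B) :=
    ((C.labelGraph i).connectedComponentMk v).supp
  have hadj : ∀ v, ∃ w, (completeBipartiteGraph A B).Adj v w := by
    rintro (a | b)
    · exact ⟨Sum.inr (Classical.arbitrary B), by simp⟩
    · exact ⟨Sum.inl (Classical.arbitrary A), by simp⟩
  have hcross : ∀ f ∈ Finset.univ.image fun a : A => comp (Sum.inl a),
      ∀ g ∈ Finset.univ.image fun b : B => comp (Sum.inr b), ∃ i, f i = g i := by
    simp only [Finset.mem_image, Finset.mem_univ, true_and, forall_exists_index,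
      forall_apply_eq_imp_iff]
    intro a b
    have h : (completeBipartiteGraph A B).Adj (Sum.inl a) (Sum.inr b) := by simp
    refine ⟨C ⟨s(Sum.inl a, Sum.inr b), h⟩, congrArg SimpleGraph.ConnectedComponent.supp
      (SimpleGraph.ConnectedComponent.sound ?_)⟩
    exact (SimpleGraph.EdgeLabeling.labelGraph_adj_of_adj h).reachable
  obtain ⟨T, hT, hTA, hTB⟩ := CrossMatching.exists_cover (by rw [Fintype.card_fin]; omega)
    (Finset.univ_nonempty.image _) (Finset.univ_nonempty.image _) hcross
  have hcov : ∀ v, ∃ i, (i, comp v i) ∈ T := by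
    rintro (a | b)
    · exact hTA _ (Finset.mem_image_of_mem _ (Finset.mem_univ a))
    · exact hTB _ (Finset.mem_image_of_mem _ (Finset.mem_univ b))
  -- Entries of `T` that are no vertex's component get an arbitrary value.
  have hM : ∀ p : Fin r × Set (A ⊕ B), ∃ M : C.MonochromaticComponent,
      (∃ v, comp v p.1 = p.2) → p.2 ⊆ M.verts := by
    rintro ⟨i, s⟩
    by_cases hs : ∃ v, comp v i = s
    · obtain ⟨v, rfl⟩ := hs
      obtain ⟨w, hw⟩ := hadj v
      exact (SimpleGraph.EdgeLabeling.exists_supp_subset_verts hw i).imp fun _ hM _ => hM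
    · obtain ⟨w, hw⟩ := hadj (Sum.inl (Classical.arbitrary A))
      exact (SimpleGraph.EdgeLabeling.exists_supp_subset_verts hw i).imp fun _ _ hs' =>
        absurd hs' hs
  choose M hM using hM
  refine ⟨T.image M, Finset.card_image_le.trans (by simpa using hT), fun v => ?_⟩
  obtain ⟨i, hi⟩ := hcov v
  exact ⟨M _, Finset.mem_image_of_mem _ hi, hM (i, comp v i) ⟨v, rfl⟩ rfl⟩
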